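/- \textbf{Setting.} Let $F$ be a fixed, known cumulative distribution function on $\mathbb R$ with $F(x)=1-F(-x)$ for all $x$, three times differentiable, and put $\mu=F$. Fix an integer $T\ge 1$ and let $p_n\in(0,1]$. For each $n$ there are $n+1$ subjects $0,\dots,n$ with true merits $\beta^*=(\beta^*_0,\dots,\beta^*_n)\in\mathbb R^{n+1}$ (depending on $n$), $\beta_0^*=0$. For $i<j$ the number $t_{ij}$ of comparisons of $i$ with $j$ is $\mathrm{Bin}(T,p_n)$, conditionally on $t_{ij}$ the number $a_{ij}$ of wins of $i$ over $j$ is $\mathrm{Bin}(t_{ij},F(\beta_i^*-\beta_j^*))$, and the pairs $(t_{ij},a_{ij})$, $i<j$, are independent; moreover $t_{ji}=t_{ij}$, $a_{ji}=t_{ij}-a_{ij}$, $t_{ii}=a_{ii}=0$. Let $a_i=\sum_{j}a_{ij}$. A moment estimator $\widehat\beta$ is any solution, with $\widehat\beta_0=0$, of $$a_i=\sum_{j\ne i}t_{ij}\,\mu(\widehat\beta_i-\widehat\beta_j),\qquad i=1,\dots,n.$$ \textbf{Assumptions.} Let $\epsilon_n,b_{n0},b_{n1},b_{n2}>0$ be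 such that for every $n$, every $\beta$ with $\beta_0=0$ and $\|\beta-\beta^*\|_\infty\le\epsilon_n$, with $\pi_{ij}=\beta_i-\beta_j$ and the minima and maxima taken over $i\ne j$, $$\Big[\min_{i,j}\mu'(\pi_{ij})\Big]\Big[\max_{i,j}\mu'(\pi_{ij})\Big]>0,\qquad b_{n0}\le\min_{i,j}|\mu'(\pi_{ij})|\le\max_{i,j}|\mu'(\pi_{ij})|\le b_{n1},\qquad \max_{i,j}|\mu''(\pi_{ij})|\le b_{n2}.$$ Put $r_n=\dfrac{b_{n1}^2}{b_{n0}^3p_n^2}\sqrt{\dfrac{\log n}{n}}$ and assume that $r_n=o(\epsilon_n)$. \textbf{Theorem (consistency).} If $b_{n1}^4b_{n2}/(b_{n0}^6p_n^4)=o\big((n/\log n)^{1/2}\big)$ as $n\to\infty$, then a moment estimator exists with probability tending to one, and every choice $\widehat\beta$ of a moment estimator (arbitrary where none exists) satisfies $$\|\widehat\beta-\beta^*\|_\infty=O_p\!\left(\frac{b_{n1}^2}{b_{n0}^3p_n^2}\sqrt{\frac{\log n}{n}}\right)\qquad\text{and}\qquad \|\widehat\beta-\beta^*\|_\infty=o_p(1).$$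 -/

import Mathlib

open MeasureTheory ProbabilityTheory Filter Topology Asymptotics

namespace PairedComparison

/-- The weight `P(X = k)` of a binomial variable `X` with `N` trials and success probability `x`
(it vanishes for `k > N`, because then the binomial coefficient does). -/
def binomialWeight (N : ℕ) (x : ℝ) (k : ℕ) : ℝ :=
  (N.choose k : ℝ) * x ^ k * (1 - x) ^ (N - k)

/-- The random arrays `t i j` (number of comparisons of `i` with `j`) and `a i j` (number of wins
of `i` over `j`) on `(Ω, P)` follow the paired comparison model with subjects `0, …, n`, merits
`β`, winning probability function `F` and an Erdős–Rényi comparison graph: for each pair `i < j`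
the number of comparisons is binomial `(T, p)`, given it the number of wins of `i` over `j` is
binomial `(t i j, F (β i - β j))`, and different pairs are independent. -/
structure IsModel {Ω : Type*} [MeasurableSpace Ω] (P : Measure Ω) (F : ℝ → ℝ) {n : ℕ}
    (β : Fin (n + 1) → ℝ) (T : ℕ) (p : ℝ) (t a : Fin (n + 1) → Fin (n + 1) → Ω → ℕ) : Prop where
  measurable_t : ∀ i j, Measurable (t i j)
  measurable_a : ∀ i j, Measurable (a i j)
  t_diag : ∀ i w, t i i w = 0
  a_diag : ∀ i w, a i i w = 0
  t_symm : ∀ i j w, t i j w = t j i w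
  a_add : ∀ i j w, a i j w + a j i w = t i j w
  law : ∀ i j, i < j → ∀ m k : ℕ,
    P.real {w | t i j w = m ∧ a i j w = k} =
      binomialWeight T p m * binomialWeight m (F (β i - β j)) k
  indep : iIndepFun
    (fun (e : {e : Fin (n + 1) × Fin (n + 1) // e.1 < e.2}) (w : Ω) =>
      (t e.1.1 e.1.2 w, a e.1.1 e.1.2 w)) P

/-- `b` solves the moment equations `a_i = ∑_j t_ij μ(b_i - b_j)`, `i = 1, …, n`, where
`a_i = ∑_j a_ij`, under the normalization `b_0 = 0`; here `t`, `a` are observed arrays. -/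
def IsMomentEstimator (μ : ℝ → ℝ) {n : ℕ} (t a : Fin (n + 1) → Fin (n + 1) → ℕ)
    (b : Fin (n + 1) → ℝ) : Prop :=
  b 0 = 0 ∧ ∀ i : Fin (n + 1), i ≠ 0 →
    ((∑ j, a i j : ℕ) : ℝ) = ∑ j, (t i j : ℝ) * μ (b i - b j)

/-- The bounds on the derivatives of `μ` in the `ε`-neighbourhood of `β` (the `0`-th coordinate
being fixed to `0`): all `μ'(π_ij)`, `i ≠ j`, have the same sign, `b0 ≤ |μ'(π_ij)| ≤ b1` and
`|μ''(π_ij)| ≤ b2`, where `π_ij = b_i - b_j`. -/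
structure DerivBounds (μ : ℝ → ℝ) {n : ℕ} (β : Fin (n + 1) → ℝ) (ε b0 b1 b2 : ℝ) : Prop where
  sign : ∀ b : Fin (n + 1) → ℝ, b 0 = 0 → (∀ i, |b i - β i| ≤ ε) →
    ∀ i j k l, i ≠ j → k ≠ l → 0 < deriv μ (b i - b j) * deriv μ (b k - b l)
  first : ∀ b : Fin (n + 1) → ℝ, b 0 = 0 → (∀ i, |b i - β i| ≤ ε) →
    ∀ i j, i ≠ j → b0 ≤ |deriv μ (b i - b j)| ∧ |deriv μ (b i - b j)| ≤ b1
  second : ∀ b : Fin (n + 1) → ℝ, b 0 = 0 → (∀ i, |b i - β i| ≤ ε) →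
    ∀ i j, i ≠ j → |deriv (deriv μ) (b i - b j)| ≤ b2

/-- `X_n = O_p(r_n)`. -/
def IsBigOp {Ω : ℕ → Type*} [∀ n, MeasurableSpace (Ω n)] (P : ∀ n, Measure (Ω n))
    (X : ∀ n, Ω n → ℝ) (r : ℕ → ℝ) : Prop :=
  ∀ δ : ℝ, 0 < δ → ∃ M : ℝ, 0 < M ∧
    ∀ᶠ n in atTop, (P n).real {w | M * r n < |X n w|} ≤ δ

/-- `X_n = o_p(1)`. -/
def IsLittleOpOne {Ω : ℕ → Type*} [∀ n, MeasurableSpace (Ω n)] (P : ∀ n, Measure (Ω n))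
    (X : ∀ n, Ω n → ℝ) : Prop :=
  ∀ δ : ℝ, 0 < δ → Tendsto (fun n => (P n).real {w | δ < |X n w|}) atTop (𝓝 0)

/-- The rate `b1² / (b0³ p²) · √(log n / n)`. -/
noncomputable def rate (b0 b1 p : ℕ → ℝ) (n : ℕ) : ℝ :=
  b1 n ^ 2 / (b0 n ^ 3 * p n ^ 2) * √(Real.log n / n)

end PairedComparison

/-!
Let `i` maximize and `k` minimize `b - β`. When `b` solves the moment equations, each term of
`residual β i - residual β k` has a sign, and each common neighbour of `i` and `k` contributes at
least `c` times the oscillation of `b - β`, truncated at `ε`. As the residuals at `β` are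
`O(√(n log n))` and the numbers of common neighbours are of order `n p²`, both by Hoeffding's
inequality, the oscillation is `O(√(log n / n) / (c p²))`. A solution exists because the moment
equations are the critical point equations of a translation invariant energy: for a minimizer over
the sup-norm ball of radius `ε` about `β`, the same maximum principle shows that the oscillation of
`b - β` is less than `ε`, so that a translate of `b` is interior.

Since `F` takes values in `[0, 1]`, `c ε ≤ 1`; a neighbourhood that is large compared with the rate
therefore forces `√(log n / n) ≤ p² / 4`, which is the density the graph needs. That the rate tends
to zero is clear where `ε` is bounded. Where `ε` is large, two of the `n + 1` merits are within
`ε / 2` of each other because the total increase of `F` is at most one, so a point at which `F''`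
does not vanish lies in the neighbourhood and bounds `b2` from below.
-/

namespace PairedComparison

section Deterministic

variable {ι : Type*} {F : ℝ → ℝ} {t a : ι → ι → ℕ} {β b : ι → ℝ} {ε c : ℝ}

/-- The arrays `t` of numbers of comparisons and `a` of numbers of wins record the results of a
tournament without draws: nobody meets himself, and every comparison has one winner. -/
structure IsTally (t a : ι → ι → ℕ) : Prop where
  diag : ∀ i, t i i = 0
  add : ∀ i j, a i j + a j i = t i j

/-- The increments of `F` to the right of each difference `β i - β j` grow at least linearly, with
slope `c`, up to distance `ε`. This is the only consequence of a lower bound `c` for `F'` near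
these differences that the deterministic argument needs. -/
def GrowsAt (F : ℝ → ℝ) (β : ι → ℝ) (ε c : ℝ) : Prop :=
  ∀ i j, i ≠ j → ∀ u, 0 ≤ u → c * min u ε ≤ F (β i - β j + u) - F (β i - β j)

lemma IsTally.symm (h : IsTally t a) (i j : ι) : t i j = t j i := by
  rw [← h.add, ← h.add, add_comm]

lemma IsTally.sub_antisymm (h : IsTally t a) (hF : ∀ x, F x = 1 - F (-x)) (b : ι → ℝ) (i j : ι) :
    (a i j : ℝ) - t i j * F (b i - b j) = -((a j i : ℝ) - t j i * F (b j - b i)) := by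
  have hadd : (a i j : ℝ) + a j i = t i j := by exact_mod_cast h.add i j
  rw [hF (b i - b j), neg_sub, h.symm j i]
  linarith

lemma GrowsAt.mul_min_le (hg : GrowsAt F β ε c) {i j : ι} (hij : i ≠ j)
    (hle : b j - β j ≤ b i - β i) :
    c * min ((b i - β i) - (b j - β j)) ε ≤ F (b i - b j) - F (β i - β j) := by
  convert hg i j hij _ (sub_nonneg.2 hle) using 3
  ring

lemma min_add_le_min_add_min {u v ε : ℝ} (hu : 0 ≤ u) (hv : 0 ≤ v) (hε : 0 ≤ ε) :
    min (u + v) ε ≤ min u ε + min v ε := by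
  grind

variable [Fintype ι]

/-- The residual of the `i`-th moment equation at `b`. -/
def residual (F : ℝ → ℝ) (t a : ι → ι → ℕ) (b : ι → ℝ) (i : ι) : ℝ :=
  ∑ j, ((a i j : ℝ) - t i j * F (b i - b j))

/-- The common neighbours of `i` and `k` in the comparison graph. -/
def commonNeighbors (t : ι → ι → ℕ) (i k : ι) : Finset ι :=
  {j | 1 ≤ t i j ∧ 1 ≤ t k j}

/-- The event of high probability on which the moment equations are well behaved: the residuals at
`β` are at most `H`, and any two subjects have at least `N` common neighbours. -/
structure IsRegular (F : ℝ → ℝ) (t a : ι → ι → ℕ) (β : ι → ℝ) (H N : ℝ) : Prop where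
  abs_residual_le : ∀ i, |residual F t a β i| ≤ H
  le_card_commonNeighbors : ∀ i k, i ≠ k → N ≤ (commonNeighbors t i k).card

/-- The potential whose critical points solve the moment equations: its gradient at `b` is
`-2 * residual F t a b`. -/
noncomputable def energy (F : ℝ → ℝ) (t a : ι → ι → ℕ) (b : ι → ℝ) : ℝ :=
  ∑ i, ∑ j, ((t i j : ℝ) * (∫ s in (0 : ℝ)..b i - b j, F s) - a i j * (b i - b j))

variable {H N : ℝ}

lemma IsTally.sum_residual (h : IsTally t a) (hF : ∀ x, F x = 1 - F (-x)) (b : ι → ℝ) :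
    ∑ i, residual F t a b i = 0 := by
  have hneg : ∑ i, residual F t a b i = -∑ i, residual F t a b i := by
    calc ∑ i, residual F t a b i
        = ∑ i, ∑ j, -((a j i : ℝ) - t j i * F (b j - b i)) :=
          Finset.sum_congr rfl fun i _ => Finset.sum_congr rfl fun j _ => h.sub_antisymm hF b i j
      _ = -∑ i, residual F t a b i := by
          rw [Finset.sum_comm]; simp only [residual, Finset.sum_neg_distrib]
  linarith

lemma residual_sub_residual (F : ℝ → ℝ) (t a : ι → ι → ℕ) (β b : ι → ℝ) (i : ι) :
    residual F t a β i - residual F t a b i =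
      ∑ j, (t i j : ℝ) * (F (b i - b j) - F (β i - β j)) := by
  simp only [residual, ← Finset.sum_sub_distrib]
  exact Finset.sum_congr rfl fun j _ => by ring

lemma sum_le_sum_natCast_mul {S : Finset ι} {w : ι → ℕ} {f g : ι → ℝ} (hf : ∀ j, 0 ≤ f j)
    (hfg : ∀ j, w j ≠ 0 → f j ≤ g j) (hS : ∀ j ∈ S, 1 ≤ w j) :
    ∑ j ∈ S, f j ≤ ∑ j, (w j : ℝ) * g j := by
  have hle : ∀ j, (w j : ℝ) * f j ≤ w j * g j := fun j => by
    by_cases hj : w j = 0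
    · simp only [hj, Nat.cast_zero, zero_mul, le_refl]
    · exact mul_le_mul_of_nonneg_left (hfg j hj) (Nat.cast_nonneg _)
  calc ∑ j ∈ S, f j
      ≤ ∑ j ∈ S, (w j : ℝ) * f j := Finset.sum_le_sum fun j hj =>
        le_mul_of_one_le_left (hf j) (Nat.one_le_cast.2 (hS j hj))
    _ ≤ ∑ j, (w j : ℝ) * f j := Finset.sum_le_univ_sum_of_nonneg fun j =>
        mul_nonneg (Nat.cast_nonneg _) (hf j)
    _ ≤ ∑ j, (w j : ℝ) * g j := Finset.sum_le_sum fun j _ => hle j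

namespace IsTally

lemma sum_mul_min_le_of_max (h : IsTally t a) (hc : 0 ≤ c) (hε : 0 ≤ ε) (hg : GrowsAt F β ε c)
    {i : ι} (hi : ∀ j, b j - β j ≤ b i - β i) {S : Finset ι} (hS : ∀ j ∈ S, 1 ≤ t i j) :
    ∑ j ∈ S, c * min ((b i - β i) - (b j - β j)) ε
      ≤ residual F t a β i - residual F t a b i := by
  rw [residual_sub_residual]
  refine sum_le_sum_natCast_mul (fun j => mul_nonneg hc (le_min (sub_nonneg.2 (hi j)) hε))
    (fun j hj => hg.mul_min_le ?_ (hi j)) hS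
  rintro rfl
  exact hj (h.diag i)

lemma sum_mul_min_le_of_min (h : IsTally t a) (hF : ∀ x, F x = 1 - F (-x)) (hc : 0 ≤ c)
    (hε : 0 ≤ ε) (hg : GrowsAt F β ε c) {k : ι} (hk : ∀ j, b k - β k ≤ b j - β j)
    {S : Finset ι} (hS : ∀ j ∈ S, 1 ≤ t k j) :
    ∑ j ∈ S, c * min ((b j - β j) - (b k - β k)) ε
      ≤ residual F t a b k - residual F t a β k := by
  rw [residual_sub_residual]
  refine sum_le_sum_natCast_mul (fun j => mul_nonneg hc (le_min (sub_nonneg.2 (hk j)) hε))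
    (fun j hj => ?_) hS
  have hjk : j ≠ k := by
    rintro rfl
    exact hj (h.diag j)
  have hgrow := hg.mul_min_le hjk (hk j)
  rw [hF (b j - b k), hF (β j - β k), neg_sub, neg_sub] at hgrow
  linarith

/-- Every common neighbour `j` of the maximizer `i` and the minimizer `k` of `b - β` sees
`(b - β) i - (b - β) j` in the `i`-th equation and `(b - β) j - (b - β) k` in the `k`-th one; these
add up to the oscillation, whatever `j` is. -/
lemma mul_min_osc_mul_card_le (h : IsTally t a) (hF : ∀ x, F x = 1 - F (-x)) (hc : 0 ≤ c)
    (hε : 0 ≤ ε) (hg : GrowsAt F β ε c) {i k : ι} (hi : ∀ j, b j - β j ≤ b i - β i)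
    (hk : ∀ j, b k - β k ≤ b j - β j) (hri : 0 ≤ residual F t a b i)
    (hrk : residual F t a b k ≤ 0) :
    c * min ((b i - β i) - (b k - β k)) ε * (commonNeighbors t i k).card
      ≤ residual F t a β i - residual F t a β k := by
  have hmem : ∀ j ∈ commonNeighbors t i k, 1 ≤ t i j ∧ 1 ≤ t k j := fun j hj =>
    (Finset.mem_filter.1 hj).2
  have hmax := h.sum_mul_min_le_of_max hc hε hg hi fun j hj => (hmem j hj).1
  have hmin := h.sum_mul_min_le_of_min hF hc hε hg hk fun j hj => (hmem j hj).2
  have hsplit : ∀ j, c * min ((b i - β i) - (b k - β k)) ε ≤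
      c * min ((b i - β i) - (b j - β j)) ε + c * min ((b j - β j) - (b k - β k)) ε := fun j => by
    rw [← mul_add, ← sub_add_sub_cancel (b i - β i) (b j - β j) (b k - β k)]
    exact mul_le_mul_of_nonneg_left
      (min_add_le_min_add_min (sub_nonneg.2 (hi j)) (sub_nonneg.2 (hk j)) hε) hc
  have hsum := Finset.sum_le_sum fun j (_ : j ∈ commonNeighbors t i k) => hsplit j
  rw [Finset.sum_const, nsmul_eq_mul, Finset.sum_add_distrib] at hsum
  linarith

lemma mul_min_osc_mul_le (h : IsTally t a) (hF : ∀ x, F x = 1 - F (-x)) (hc : 0 ≤ c)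
    (hε : 0 ≤ ε) (hg : GrowsAt F β ε c) (hreg : IsRegular F t a β H N) {i k : ι} (hik : i ≠ k)
    (hi : ∀ j, b j - β j ≤ b i - β i) (hk : ∀ j, b k - β k ≤ b j - β j)
    (hri : 0 ≤ residual F t a b i) (hrk : residual F t a b k ≤ 0) :
    c * min ((b i - β i) - (b k - β k)) ε * N ≤ 2 * H := by
  have hosc := h.mul_min_osc_mul_card_le hF hc hε hg hi hk hri hrk
  have hN := mul_le_mul_of_nonneg_left (hreg.le_card_commonNeighbors i k hik)
    (mul_nonneg hc (le_min (sub_nonneg.2 (hk i)) hε))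
  have hHi := (abs_le.1 (hreg.abs_residual_le i)).2
  have hHk := (abs_le.1 (hreg.abs_residual_le k)).1
  linarith

lemma sub_le_of_residual_eq_zero {R : ℝ} (h : IsTally t a) (hF : ∀ x, F x = 1 - F (-x))
    (hc : 0 < c) (hR : 0 ≤ R) (hRε : R < ε) (hg : GrowsAt F β ε c)
    (hreg : IsRegular F t a β H N) (hN : 0 < N) (hHN : 2 * H ≤ c * R * N)
    (hb : ∀ i, residual F t a b i = 0) (j l : ι) : (b j - β j) - (b l - β l) ≤ R := by
  have : Nonempty ι := ⟨j⟩
  obtain ⟨i, hi⟩ := Finite.exists_max fun j => b j - β j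
  obtain ⟨k, hk⟩ := Finite.exists_min fun j => b j - β j
  suffices hosc : (b i - β i) - (b k - β k) ≤ R by linarith [hi j, hk l]
  by_contra! hlt
  have hik : i ≠ k := by rintro rfl; linarith
  have hle := h.mul_min_osc_mul_le hF hc.le (hR.trans hRε.le) hg hreg hik hi hk (hb i).ge (hb k).le
  have hlt' := mul_lt_mul_of_pos_right (mul_lt_mul_of_pos_left (lt_min hlt hRε) hc) hN
  linarith

lemma hasFDerivAt_energy (h : IsTally t a) (hF : ∀ x, F x = 1 - F (-x)) (hFc : Continuous F)
    (b : ι → ℝ) :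
    HasFDerivAt (energy F t a)
      (∑ i, (-2 * residual F t a b i) • ContinuousLinearMap.proj (R := ℝ) (φ := fun _ : ι => ℝ) i)
      b := by
  let π : ι → (ι → ℝ) →L[ℝ] ℝ := ContinuousLinearMap.proj (R := ℝ) (φ := fun _ : ι => ℝ)
  have hterm : ∀ i j, HasFDerivAt (fun b : ι → ℝ =>
      (t i j : ℝ) * (∫ s in (0 : ℝ)..b i - b j, F s) - a i j * (b i - b j))
      (-((a i j : ℝ) - t i j * F (b i - b j)) • (π i - π j)) b := fun i j => by
    have hdiff : HasFDerivAt (fun b : ι → ℝ => b i - b j) (π i - π j) b :=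
      (π i).hasFDerivAt.sub (π j).hasFDerivAt
    have hint := (hFc.integral_hasStrictDerivAt 0 (b i - b j)).hasDerivAt.comp_hasFDerivAt b hdiff
    refine ((hint.const_mul (t i j : ℝ)).sub (hdiff.const_mul (a i j : ℝ))).congr_fderiv ?_
    module
  refine (HasFDerivAt.fun_sum fun i _ => HasFDerivAt.fun_sum fun j _ => hterm i j).congr_fderiv ?_
  have hrow : ∑ i, ∑ j, ((a i j : ℝ) - t i j * F (b i - b j)) • π i =
      ∑ i, residual F t a b i • π i := by
    simp only [residual, Finset.sum_smul]
  have hcolumn : ∑ i, ∑ j, ((a i j : ℝ) - t i j * F (b i - b j)) • π j =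
      -∑ i, residual F t a b i • π i := by
    rw [Finset.sum_comm]
    simp only [residual, Finset.sum_smul, ← Finset.sum_neg_distrib, ← neg_smul,
      ← h.sub_antisymm hF]
  simp only [neg_smul, smul_sub, Finset.sum_neg_distrib, Finset.sum_sub_distrib, hrow, hcolumn,
    mul_smul, ← Finset.smul_sum]
  module

lemma sum_residual_mul_sub_nonpos (h : IsTally t a) (hF : ∀ x, F x = 1 - F (-x))
    (hFc : Continuous F) {s : Set (ι → ℝ)} (hs : Convex ℝ s) (hmin : IsMinOn (energy F t a) s b)
    (hb : b ∈ s) {b' : ι → ℝ} (hb' : b' ∈ s) :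
    ∑ i, residual F t a b i * (b' i - b i) ≤ 0 := by
  have hderiv := hmin.localize.hasFDerivWithinAt_nonneg
    (h.hasFDerivAt_energy hF hFc b).hasFDerivWithinAt
    (sub_mem_posTangentConeAt_of_segment_subset (hs.segment_subset hb hb'))
  simp only [sum_apply, smul_apply,
    ContinuousLinearMap.proj_apply, Pi.sub_apply, smul_eq_mul, mul_assoc, ← Finset.mul_sum]
    at hderiv
  linarith

lemma residual_mul_sub_nonpos (h : IsTally t a) (hF : ∀ x, F x = 1 - F (-x))
    (hFc : Continuous F) (hmin : IsMinOn (energy F t a) (Metric.closedBall β ε) b)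
    (hb : b ∈ Metric.closedBall β ε) (i : ι) {x : ℝ} (hx : |x - β i| ≤ ε) :
    residual F t a b i * (x - b i) ≤ 0 := by
  classical
  have hε : 0 ≤ ε := (abs_nonneg _).trans hx
  have hb' : Function.update b i x ∈ Metric.closedBall β ε := by
    rw [Metric.mem_closedBall, dist_pi_le_iff hε] at hb ⊢
    intro j
    by_cases hj : j = i
    · subst hj; rwa [Function.update_self]
    · rw [Function.update_of_ne hj]; exact hb j
  have hsum := h.sum_residual_mul_sub_nonpos hF hFc (convex_closedBall β ε) hmin hb hb'
  rwa [Finset.sum_eq_single i (fun j _ hj => by rw [Function.update_of_ne hj, sub_self, mul_zero])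
    (fun hi => absurd (Finset.mem_univ i) hi), Function.update_self] at hsum

lemma residual_eq_zero_of_isMinOn (h : IsTally t a) (hF : ∀ x, F x = 1 - F (-x))
    (hFc : Continuous F) (hmin : IsMinOn (energy F t a) (Metric.closedBall β ε) b) {i : ι}
    (hb : ∀ j, |b j - β j| < ε) : residual F t a b i = 0 := by
  have hε : 0 < ε := (abs_nonneg _).trans_lt (hb i)
  have hmem : b ∈ Metric.closedBall β ε := by
    rw [Metric.mem_closedBall, dist_pi_le_iff hε.le]
    exact fun j => (hb j).le
  have hright := h.residual_mul_sub_nonpos hF hFc hmin hmem i (x := β i + ε)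
    (by rw [add_sub_cancel_left, abs_of_pos hε])
  have hleft := h.residual_mul_sub_nonpos hF hFc hmin hmem i (x := β i - ε)
    (by rw [sub_sub_cancel_left, abs_neg, abs_of_pos hε])
  have hbi := abs_lt.1 (hb i)
  nlinarith

end IsTally

lemma energy_add_const (F : ℝ → ℝ) (t a : ι → ι → ℕ) (b : ι → ℝ) (s : ℝ) :
    energy F t a (fun i => b i + s) = energy F t a b := by
  simp only [energy, add_sub_add_right_eq_sub]

/-- The minimizer over a ball solves the equations once it is interior. It need not be, but it has
oscillation less than the radius by the maximum principle, so that a translate of it, which has the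
same energy, is. -/
lemma IsTally.exists_residual_eq_zero [Nonempty ι] (h : IsTally t a) (hF : ∀ x, F x = 1 - F (-x))
    (hFc : Continuous F) (hc : 0 ≤ c) (hε : 0 < ε) (hg : GrowsAt F β ε c)
    (hreg : IsRegular F t a β H N) (hHN : 2 * H < c * ε * N) :
    ∃ b, ∀ i, residual F t a b i = 0 := by
  have hcont : Continuous (energy F t a) :=
    continuous_iff_continuousAt.2 fun b => (h.hasFDerivAt_energy hF hFc b).continuousAt
  obtain ⟨b, hb, hmin⟩ := (isCompact_closedBall β ε).exists_isMinOn
    ⟨β, Metric.mem_closedBall_self hε.le⟩ hcont.continuousOn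
  have hbε : ∀ i, |b i - β i| ≤ ε := (dist_pi_le_iff hε.le).1 (Metric.mem_closedBall.1 hb)
  obtain ⟨i, hi⟩ := Finite.exists_max fun j => b j - β j
  obtain ⟨k, hk⟩ := Finite.exists_min fun j => b j - β j
  have hosc : (b i - β i) - (b k - β k) < ε := by
    by_contra! hle
    have hik : i ≠ k := by rintro rfl; linarith
    have hbi := abs_le.1 (hbε i)
    have hbk := abs_le.1 (hbε k)
    have hri := h.residual_mul_sub_nonpos hF hFc hmin hb i (x := β i - ε)
      (by rw [sub_sub_cancel_left, abs_neg, abs_of_pos hε])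
    have hrk := h.residual_mul_sub_nonpos hF hFc hmin hb k (x := β k + ε)
      (by rw [add_sub_cancel_left, abs_of_pos hε])
    have hbound := h.mul_min_osc_mul_le hF hc hε.le hg hreg hik hi hk
      (by nlinarith) (by nlinarith)
    rw [min_eq_right hle] at hbound
    linarith
  refine ⟨fun j => b j + (β k - b k), fun j => h.residual_eq_zero_of_isMinOn hF hFc (ε := ε)
    (β := β) (fun b' hb' => ?_) fun j => ?_⟩
  · rw [Set.mem_ofPred_eq, energy_add_const]
    exact hmin hb'
  · rw [abs_lt]
    constructor <;> linarith [hi j, hk j]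

end Deterministic

section MomentEstimator

variable {n : ℕ} {F : ℝ → ℝ} {t a : Fin (n + 1) → Fin (n + 1) → ℕ} {β b : Fin (n + 1) → ℝ}
  {ε c H N : ℝ}

lemma isMomentEstimator_iff_residual :
    IsMomentEstimator F t a b ↔ b 0 = 0 ∧ ∀ i, i ≠ 0 → residual F t a b i = 0 := by
  simp only [IsMomentEstimator, residual, Finset.sum_sub_distrib, sub_eq_zero, Nat.cast_sum]

lemma IsMomentEstimator.residual_eq_zero (hb : IsMomentEstimator F t a b) (h : IsTally t a)
    (hF : ∀ x, F x = 1 - F (-x)) (i : Fin (n + 1)) : residual F t a b i = 0 := by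
  rw [isMomentEstimator_iff_residual] at hb
  by_cases hi : i = 0
  · rw [hi, ← h.sum_residual hF b, Fintype.sum_eq_single 0 hb.2]
  · exact hb.2 i hi

lemma IsTally.exists_isMomentEstimator (h : IsTally t a) (hF : ∀ x, F x = 1 - F (-x))
    (hFc : Continuous F) (hc : 0 ≤ c) (hε : 0 < ε) (hg : GrowsAt F β ε c)
    (hreg : IsRegular F t a β H N) (hHN : 2 * H < c * ε * N) : ∃ b, IsMomentEstimator F t a b := by
  obtain ⟨b, hb⟩ := h.exists_residual_eq_zero hF hFc hc hε hg hreg hHN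
  refine ⟨fun i => b i - b 0, isMomentEstimator_iff_residual.2 ⟨sub_self _, fun i _ => ?_⟩⟩
  simpa only [residual, sub_sub_sub_cancel_right] using hb i

lemma IsMomentEstimator.norm_sub_le {R : ℝ} (hb : IsMomentEstimator F t a b) (h : IsTally t a)
    (hF : ∀ x, F x = 1 - F (-x)) (hβ : β 0 = 0) (hc : 0 < c) (hR : 0 ≤ R) (hRε : R < ε)
    (hg : GrowsAt F β ε c) (hreg : IsRegular F t a β H N) (hN : 0 < N)
    (hHN : 2 * H ≤ c * R * N) : ‖b - β‖ ≤ R := by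
  have hosc := h.sub_le_of_residual_eq_zero hF hc hR hRε hg hreg hN hHN (hb.residual_eq_zero h hF)
  rw [pi_norm_le_iff_of_nonneg hR]
  intro j
  have hj := hosc j 0
  have h0 := hosc 0 j
  rw [hb.1, hβ] at hj h0
  rw [Pi.sub_apply, Real.norm_eq_abs, abs_le]
  constructor <;> linarith

end MomentEstimator

section Concentration

variable {κ α Ω : Type*} [MeasurableSpace Ω] {P : Measure Ω}

lemma iIndepSet_iInter_snd {l : Type*} [Finite l] {E : κ × l → Set Ω}
    (hE : ∀ x, MeasurableSet (E x)) (h : iIndepSet E P) :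
    iIndepSet (fun k => ⋂ j, E (k, j)) P := by
  cases nonempty_fintype l
  have hprod : ∀ s : Finset κ,
      P (⋂ k ∈ s, ⋂ j, E (k, j)) = ∏ k ∈ s, ∏ j, P (E (k, j)) := fun s => by
    have hinter : ⋂ k ∈ s, ⋂ j, E (k, j) = ⋂ x ∈ s ×ˢ (Finset.univ : Finset l), E x := by
      ext w
      simp only [Set.mem_iInter, Finset.mem_product, Finset.mem_univ, and_true, Prod.forall]
      exact forall_congr' fun k => forall_comm
    rw [hinter, h.meas_biInter, Finset.prod_product]
  refine (iIndepSet_iff_meas_biInter fun k => MeasurableSet.iInter fun j => hE (k, j)).2 fun s => ?_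
  rw [hprod]
  exact Finset.prod_congr rfl fun k _ => by simpa using (hprod {k}).symm

lemma integral_comp_eq_sum [MeasurableSpace α] [MeasurableSingletonClass α] [Countable α]
    [IsFiniteMeasure P] {X : Ω → α} (hX : Measurable X) {s : Finset α} (hs : ∀ᵐ w ∂P, X w ∈ s)
    (g : α → ℝ) : ∫ w, g (X w) ∂P = ∑ x ∈ s, P.real {w | X w = x} * g x := by
  have hmap : ∀ᵐ x ∂P.map X, x ∈ (s : Set α) :=
    (ae_map_iff hX.aemeasurable s.measurableSet).2 hs
  rw [← integral_map hX.aemeasurable (measurable_of_countable g).aestronglyMeasurable,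
    ← Measure.restrict_eq_self_of_ae_mem hmap, setIntegral_finset s IntegrableOn.finset]
  refine Finset.sum_congr rfl fun x _ => ?_
  rw [map_measureReal_apply hX (measurableSet_singleton x), smul_eq_mul]
  rfl

variable [Fintype κ]

lemma measureReal_le_abs_sum_le {X : κ → Ω → ℝ} {c : NNReal} (hind : iIndepFun X P)
    (hX : ∀ k, HasSubgaussianMGF (X k) c P) {s : ℝ} (hs : 0 ≤ s) :
    P.real {w | s ≤ |∑ k, X k w|} ≤ 2 * Real.exp (-s ^ 2 / (2 * (Fintype.card κ * c))) := by
  have := hind.isProbabilityMeasure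
  have hupper := HasSubgaussianMGF.measure_sum_ge_le_of_iIndepFun hind (s := Finset.univ)
    (fun k _ => hX k) hs
  have hlower := HasSubgaussianMGF.measure_sum_ge_le_of_iIndepFun (X := fun k w => -X k w)
    (hind.comp (γ := fun _ => ℝ) (fun _ x => -x) (fun _ => measurable_neg)) (s := Finset.univ)
    (fun k _ => (hX k).neg) hs
  have hsub : {w | s ≤ |∑ k, X k w|} ⊆ {w | s ≤ ∑ k, X k w} ∪ {w | s ≤ ∑ k, -X k w} := by
    intro w hw
    simpa only [Set.mem_union, Set.mem_ofPred_eq, Finset.sum_neg_distrib] using le_abs.1 hw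
  simp only [Finset.sum_const, Finset.card_univ, nsmul_eq_mul, NNReal.coe_mul, NNReal.coe_natCast]
    at hupper hlower
  calc P.real {w | s ≤ |∑ k, X k w|}
      ≤ P.real {w | s ≤ ∑ k, X k w} + P.real {w | s ≤ ∑ k, -X k w} :=
        (measureReal_mono hsub).trans (measureReal_union_le _ _)
    _ ≤ 2 * Real.exp (-s ^ 2 / (2 * (Fintype.card κ * c))) := by linarith

lemma measureReal_sum_indicator_le_le {S : κ → Set Ω} (hS : ∀ k, MeasurableSet (S k))
    (hind : iIndepSet S P) {q : ℝ} (hq0 : 0 ≤ q) (hq : ∀ k, q ≤ P.real (S k)) :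
    P.real {w | ∑ k, (S k).indicator (fun _ => (1 : ℝ)) w ≤ Fintype.card κ * q / 2}
      ≤ Real.exp (-(Fintype.card κ * q ^ 2 / 2)) := by
  have := hind.isProbabilityMeasure
  let Y : κ → Ω → ℝ := fun k => (S k).indicator fun _ => 1
  have hmean : ∀ k, ∫ w, Y k w ∂P = P.real (S k) := fun k => integral_indicator_one (hS k)
  have hsub : ∀ k, HasSubgaussianMGF (fun w => -(Y k w - ∫ w, Y k w ∂P))
      ((‖(1 : ℝ) - 0‖₊ / 2) ^ 2) P := fun k =>
    (hasSubgaussianMGF_of_mem_Icc (measurable_const.indicator (hS k)).aemeasurable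
      (ae_of_all _ fun w => ⟨Set.indicator_nonneg (fun _ _ => zero_le_one) w,
        Set.indicator_le_self' (fun _ _ => zero_le_one) w⟩)).neg
  have htail := HasSubgaussianMGF.measure_sum_ge_le_of_iIndepFun
    (hind.iIndepFun_indicator.comp (γ := fun _ => ℝ) (fun k x => -(x - ∫ w, Y k w ∂P))
      (fun k => by fun_prop)) (s := Finset.univ) (fun k _ => hsub k)
    (ε := Fintype.card κ * q / 2) (by positivity)
  refine (measureReal_mono fun w hw => ?_).trans (htail.trans_eq ?_)
  · have hsum : Fintype.card κ * q ≤ ∑ k, P.real (S k) := by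
      simpa [nsmul_eq_mul] using Finset.card_nsmul_le_sum Finset.univ _ q fun k _ => hq k
    simp only [Set.mem_ofPred_eq, Function.comp_apply, Finset.sum_neg_distrib,
      Finset.sum_sub_distrib, hmean] at hw ⊢
    linarith
  · have hc : ((∑ _k : κ, (‖(1 : ℝ) - 0‖₊ / 2) ^ 2 : NNReal) : ℝ) = Fintype.card κ / 4 := by
      simp only [Finset.sum_const, Finset.card_univ, sub_zero, nnnorm_one, nsmul_eq_mul]
      push_cast
      ring
    rw [hc]
    rcases eq_or_ne (Fintype.card κ : ℝ) 0 with h0 | h0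
    · simp [h0]
    · congr 1
      field_simp
      ring

end Concentration

section Model

variable {n : ℕ} {Ω : Type*} [MeasurableSpace Ω] {P : Measure Ω}
  {F : ℝ → ℝ} {β : Fin (n + 1) → ℝ} {T : ℕ} {p : ℝ} {t a : Fin (n + 1) → Fin (n + 1) → Ω → ℕ}

lemma sum_binomialWeight_mul_sub {m M : ℕ} (hm : m ≤ M) (x : ℝ) :
    ∑ k ∈ Finset.range (M + 1), binomialWeight m x k * (k - m * x) = 0 := by
  have hmass := congrArg (Polynomial.eval x) (bernsteinPolynomial.sum ℝ m)
  have hmean := congrArg (Polynomial.eval x) (bernsteinPolynomial.sum_smul ℝ m)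
  simp only [bernsteinPolynomial, Polynomial.eval_finsetSum, nsmul_eq_mul, Polynomial.eval_mul,
    Polynomial.eval_natCast, Polynomial.eval_pow, Polynomial.eval_X, Polynomial.eval_sub,
    Polynomial.eval_one] at hmass hmean
  rw [← Finset.sum_subset (Finset.range_subset_range.2 (Nat.succ_le_succ hm))]
  · simp only [mul_sub, Finset.sum_sub_distrib, ← Finset.sum_mul, binomialWeight, hmass,
      mul_comm _ ((_ : ℕ) : ℝ)] at hmean ⊢
    linarith
  · intro k _ hk
    rw [binomialWeight, Nat.choose_eq_zero_of_lt (by simpa using hk)]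
    simp only [Nat.cast_zero, zero_mul]

namespace IsModel

lemma isTally (hM : IsModel P F β T p t a) (w : Ω) :
    IsTally (fun i j => t i j w) (fun i j => a i j w) :=
  ⟨fun i => hM.t_diag i w, fun i j => hM.a_add i j w⟩

lemma iIndepFun_of_injective {κ : Type*} {u v : κ → Fin (n + 1)} (hM : IsModel P F β T p t a)
    (huv : ∀ k, u k ≠ v k) (hinj : Function.Injective fun k => s(u k, v k)) :
    iIndepFun (fun k w => (t (u k) (v k) w, a (u k) (v k) w)) P := by
  let e : κ → {e : Fin (n + 1) × Fin (n + 1) // e.1 < e.2} := fun k =>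
    ⟨(min (u k) (v k), max (u k) (v k)), min_lt_max.2 (huv k)⟩
  have hmk : ∀ k, s((e k).1.1, (e k).1.2) = s(u k, v k) := fun k => by
    rcases le_total (u k) (v k) with h | h
    · simp only [e, min_eq_left h, max_eq_right h]
    · simp only [e, min_eq_right h, max_eq_left h, Sym2.eq_swap]
  have he : Function.Injective e := fun k l hkl => hinj <| by
    have hval := congrArg Subtype.val hkl
    simp only [← hmk, hval]
  convert (hM.indep.precomp he).comp (γ := fun _ => ℕ × ℕ)
    (fun k x => if u k < v k then x else (x.1, x.1 - x.2)) (fun k => measurable_of_countable _)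
    using 2 with k
  funext w
  rcases (huv k).lt_or_gt with h | h
  · simp only [e, Function.comp_apply, h, if_true, min_eq_left h.le, max_eq_right h.le]
  · simp only [e, Function.comp_apply, h.not_gt, if_false, min_eq_right h.le, max_eq_left h.le,
      hM.t_symm (v k) (u k), ← hM.a_add (u k) (v k), Nat.add_sub_cancel_right]

lemma measurableSet_compared (hM : IsModel P F β T p t a) (i j : Fin (n + 1)) :
    MeasurableSet {w | 1 ≤ t i j w} :=
  hM.measurable_t i j measurableSet_Ici

lemma iIndepSet_compared {κ : Type*} {u v : κ → Fin (n + 1)} (hM : IsModel P F β T p t a)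
    (huv : ∀ k, u k ≠ v k) (hinj : Function.Injective fun k => s(u k, v k)) :
    iIndepSet (fun k => {w | 1 ≤ t (u k) (v k) w}) P :=
  (iIndepSet_iff_meas_biInter fun k => hM.measurableSet_compared (u k) (v k)).2 fun _ =>
    (hM.iIndepFun_of_injective huv hinj).meas_biInter fun _ _ =>
      ⟨{x | 1 ≤ x.1}, MeasurableSet.of_discrete, rfl⟩

lemma iIndepSet_compared_both (hM : IsModel P F β T p t a) {i j : Fin (n + 1)} (hij : i ≠ j) :
    iIndepSet (fun k : {k // k ≠ i ∧ k ≠ j} => {w | 1 ≤ t i k w ∧ 1 ≤ t j k w}) P := by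
  let u : {k // k ≠ i ∧ k ≠ j} × Bool → Fin (n + 1) := fun x => cond x.2 i j
  have hne : ∀ (x : {k // k ≠ i ∧ k ≠ j} × Bool) (k : {k // k ≠ i ∧ k ≠ j}), u x ≠ k := by
    rintro ⟨-, _ | _⟩ k
    exacts [k.2.2.symm, k.2.1.symm]
  have hinj : Function.Injective fun x => s(u x, (x.1 : Fin (n + 1))) := by
    rintro ⟨k, x⟩ ⟨l, y⟩ hxy
    obtain ⟨hcond, hkl⟩ := (Sym2.eq_iff.1 hxy).resolve_right fun h => hne _ _ h.1
    refine Prod.ext (Subtype.ext hkl) ?_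
    revert hcond
    cases x <;> cases y <;> simp [u, hij, hij.symm]
  have hgrid := iIndepSet_iInter_snd (fun x => hM.measurableSet_compared (u x) x.1)
    (hM.iIndepSet_compared (fun x => hne x x.1) hinj)
  convert hgrid using 2 with k
  ext w
  simp only [u, Set.mem_ofPred_eq, Set.mem_iInter, Bool.forall_bool, cond_true, cond_false,
    and_comm]

lemma measurable_residual_term (hM : IsModel P F β T p t a) (i j : Fin (n + 1)) (x : ℝ) :
    Measurable fun w => (a i j w : ℝ) - t i j w * x :=
  (measurable_from_nat.comp (hM.measurable_a i j)).sub
    ((measurable_from_nat.comp (hM.measurable_t i j)).mul_const x)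

variable [IsProbabilityMeasure P]

lemma ae_le_trials (hM : IsModel P F β T p t a) (i j : Fin (n + 1)) : ∀ᵐ w ∂P, t i j w ≤ T := by
  wlog hij : i < j generalizing i j
  · rcases (not_lt.1 hij).eq_or_lt with rfl | hji
    · exact ae_of_all _ fun w => by rw [hM.t_diag]; exact Nat.zero_le T
    · simpa only [hM.t_symm i j] using this j i hji
  have hzero : ∀ m k : ℕ, T < m → ∀ᵐ w ∂P, ¬ (t i j w = m ∧ a i j w = k) := fun m k hm => by
    have hlaw := hM.law i j hij m k
    rw [binomialWeight, Nat.choose_eq_zero_of_lt hm, Nat.cast_zero, zero_mul, zero_mul, zero_mul,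
      measureReal_eq_zero_iff] at hlaw
    exact measure_eq_zero_iff_ae_notMem.1 hlaw
  have hall : ∀ᵐ w ∂P, ∀ m k : ℕ, T < m → ¬ (t i j w = m ∧ a i j w = k) := by
    simpa only [ae_all_iff] using hzero
  filter_upwards [hall] with w hw
  by_contra! hlt
  exact hw _ _ hlt ⟨rfl, rfl⟩

lemma integral_residual_term (hM : IsModel P F β T p t a) (hF : ∀ x, F x = 1 - F (-x))
    {i j : Fin (n + 1)} (hij : i ≠ j) :
    ∫ w, ((a i j w : ℝ) - t i j w * F (β i - β j)) ∂P = 0 := by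
  wlog hlt : i < j generalizing i j
  · simp only [fun w => (hM.isTally w).sub_antisymm hF β i j]
    rw [integral_neg, this hij.symm (hij.lt_or_gt.resolve_left hlt), neg_zero]
  have hmem : ∀ᵐ w ∂P, (t i j w, a i j w) ∈ Finset.range (T + 1) ×ˢ Finset.range (T + 1) := by
    filter_upwards [hM.ae_le_trials i j] with w hw
    have hadd := hM.a_add i j w
    rw [Finset.mem_product, Finset.mem_range, Finset.mem_range]
    omega
  have hsum := integral_comp_eq_sum ((hM.measurable_t i j).prodMk (hM.measurable_a i j)) hmem
    fun x => (x.2 : ℝ) - x.1 * F (β i - β j)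
  rw [hsum, Finset.sum_product]
  refine Finset.sum_eq_zero fun m hm => ?_
  simp only [Prod.mk.injEq, hM.law i j hlt, mul_assoc, ← Finset.mul_sum]
  rw [sum_binomialWeight_mul_sub (Nat.lt_succ_iff.1 (Finset.mem_range.1 hm)), mul_zero]

lemma hasSubgaussianMGF_residual_term (hM : IsModel P F β T p t a) (hF : ∀ x, F x = 1 - F (-x))
    (hF0 : ∀ x, 0 ≤ F x) {i j : Fin (n + 1)} (hij : i ≠ j) :
    HasSubgaussianMGF (fun w => (a i j w : ℝ) - t i j w * F (β i - β j))
      ((‖(T : ℝ) - -T‖₊ / 2) ^ 2) P := by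
  refine hasSubgaussianMGF_of_mem_Icc_of_integral_eq_zero
    (hM.measurable_residual_term i j _).aemeasurable ?_ (hM.integral_residual_term hF hij)
  filter_upwards [hM.ae_le_trials i j] with w hw
  have ht : (t i j w : ℝ) ≤ T := Nat.cast_le.2 hw
  have hadd : (a i j w : ℝ) + a j i w = t i j w := by exact_mod_cast hM.a_add i j w
  have hF1 : F (β i - β j) ≤ 1 := by linarith [hF (β i - β j), hF0 (-(β i - β j))]
  have hlower : 0 ≤ (t i j w : ℝ) * F (β i - β j) := mul_nonneg (Nat.cast_nonneg _) (hF0 _)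
  have hupper : (t i j w : ℝ) * F (β i - β j) ≤ t i j w :=
    mul_le_of_le_one_right (Nat.cast_nonneg _) hF1
  constructor <;> linarith [(a i j w).cast_nonneg (α := ℝ), (a j i w).cast_nonneg (α := ℝ)]

lemma measureReal_le_abs_residual_le (hM : IsModel P F β T p t a) (hF : ∀ x, F x = 1 - F (-x))
    (hF0 : ∀ x, 0 ≤ F x) (i : Fin (n + 1)) {s : ℝ} (hs : 0 ≤ s) :
    P.real {w | s ≤ |residual F (fun i j => t i j w) (fun i j => a i j w) β i|}
      ≤ 2 * Real.exp (-s ^ 2 / (2 * (n * (T : ℝ) ^ 2))) := by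
  let X : {j // j ≠ i} → Ω → ℝ := fun j w => (a i j w : ℝ) - t i j w * F (β i - β j)
  have hresidual : ∀ w, residual F (fun i j => t i j w) (fun i j => a i j w) β i = ∑ j, X j w :=
    fun w => by
      have hdiag : a i i w = 0 := by have := hM.a_add i i w; have := hM.t_diag i w; omega
      rw [residual, Fintype.sum_eq_add_sum_subtype_ne _ i]
      simp only [hdiag, hM.t_diag, Nat.cast_zero, zero_mul, sub_zero, zero_add, X]
  have hind : iIndepFun X P := (hM.iIndepFun_of_injective (u := fun _ => i) (v := Subtype.val)
    (fun j : {j // j ≠ i} => j.2.symm) fun j k h => Subtype.ext (Sym2.congr_right.1 h)).comp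
      (γ := fun _ => ℝ) (fun j x => (x.2 : ℝ) - x.1 * F (β i - β j))
      (fun j => measurable_of_countable _)
  have hcard : (Fintype.card {j // j ≠ i} : ℝ) = n := by
    simp [Fintype.card_subtype_compl]
  have hT : (((‖(T : ℝ) - -T‖₊ / 2) ^ 2 : NNReal) : ℝ) = (T : ℝ) ^ 2 := by
    rw [sub_neg_eq_add, ← two_mul]
    simp
  have htail := measureReal_le_abs_sum_le hind
    (fun j => hM.hasSubgaussianMGF_residual_term hF hF0 j.2.symm) hs
  rw [hcard, hT] at htail
  simpa only [hresidual] using htail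

lemma le_measureReal_compared (hM : IsModel P F β T p t a) (hT : 1 ≤ T) (hp0 : 0 < p)
    (hp1 : p ≤ 1) {i j : Fin (n + 1)} (hij : i ≠ j) : p ≤ P.real {w | 1 ≤ t i j w} := by
  wlog hlt : i < j generalizing i j
  · simpa only [hM.t_symm i j] using this hij.symm (hij.lt_or_gt.resolve_left hlt)
  have hcompl : {w | t i j w = 0 ∧ a i j w = 0} = {w | 1 ≤ t i j w}ᶜ := by
    ext w
    have hadd := hM.a_add i j w
    simp only [Set.mem_ofPred_eq, Set.mem_compl_iff]
    omega
  have hlaw := hM.law i j hlt 0 0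
  rw [hcompl, probReal_compl_eq_one_sub (hM.measurableSet_compared i j)] at hlaw
  simp only [binomialWeight, Nat.choose_self, Nat.choose_zero_right, Nat.cast_one, pow_zero,
    Nat.sub_zero, mul_one, one_mul] at hlaw
  have hpow := pow_le_of_le_one (sub_nonneg.2 hp1) (sub_le_self 1 hp0.le)
    (Nat.one_le_iff_ne_zero.1 hT)
  linarith

lemma sq_le_measureReal_compared_both (hM : IsModel P F β T p t a) (hT : 1 ≤ T) (hp0 : 0 < p)
    (hp1 : p ≤ 1) {i j k : Fin (n + 1)} (hij : i ≠ j) (hki : k ≠ i) (hkj : k ≠ j) :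
    p ^ 2 ≤ P.real {w | 1 ≤ t i k w ∧ 1 ≤ t j k w} := by
  have hind := hM.iIndepSet_compared (u := fun x : Bool => cond x i j) (v := fun _ => k)
    (by rintro (_ | _); exacts [hkj.symm, hki.symm])
    fun x y hxy => by
      have hcond := Sym2.congr_left.1 hxy
      revert hcond
      cases x <;> cases y <;> simp [hij, hij.symm]
  have hinter : {w | 1 ≤ t i k w ∧ 1 ≤ t j k w} =
      ⋂ x ∈ (Finset.univ : Finset Bool), {w | 1 ≤ t (cond x i j) k w} := by
    ext w
    simp only [Set.mem_ofPred_eq, Set.mem_iInter, Finset.mem_univ, forall_true_left,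
      Bool.forall_bool, cond_true, cond_false, and_comm]
  rw [hinter, measureReal_def, hind.meas_biInter, Fintype.prod_bool, ENNReal.toReal_mul, sq]
  exact mul_le_mul (hM.le_measureReal_compared hT hp0 hp1 hki.symm)
    (hM.le_measureReal_compared hT hp0 hp1 hkj.symm) hp0.le measureReal_nonneg

lemma measureReal_card_commonNeighbors_le_le (hM : IsModel P F β T p t a) (hT : 1 ≤ T)
    (hp0 : 0 < p) (hp1 : p ≤ 1) {i j : Fin (n + 1)} (hij : i ≠ j) :
    P.real {w | ((commonNeighbors (fun i j => t i j w) i j).card : ℝ) ≤ (n - 1) * p ^ 2 / 2}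
      ≤ Real.exp (-((n - 1) * p ^ 4 / 2)) := by
  let S : {k // k ≠ i ∧ k ≠ j} → Set Ω := fun k => {w | 1 ≤ t i k w ∧ 1 ≤ t j k w}
  have hcard : (Fintype.card {k // k ≠ i ∧ k ≠ j} : ℝ) = n - 1 := by
    have hcompl : Fintype.card {k // k ≠ i ∧ k ≠ j} = ({i, j}ᶜ : Finset (Fin (n + 1))).card := by
      rw [Fintype.card_subtype]
      congr 1
      ext k
      simp
    have hn : 1 ≤ n := by
      by_contra! h
      exact hij (Fin.ext (by omega))
    rw [hcompl, Finset.card_compl, Finset.card_pair hij, Fintype.card_fin, Nat.cast_sub (by omega)]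
    push_cast
    ring
  have htail := measureReal_sum_indicator_le_le (S := S)
    (fun k => (hM.measurableSet_compared i k).inter (hM.measurableSet_compared j k))
    (hM.iIndepSet_compared_both hij) (sq_nonneg p)
    fun k => hM.sq_le_measureReal_compared_both hT hp0 hp1 hij k.2.1 k.2.2
  rw [hcard, ← pow_mul] at htail
  have hle : ∀ w, ∑ k, (S k).indicator (fun _ => (1 : ℝ)) w ≤
      (commonNeighbors (fun i j => t i j w) i j).card := fun w => by
    have hcount : ∑ k, (S k).indicator (fun _ => (1 : ℝ)) w =
        (Finset.univ.filter fun k => w ∈ S k).card := by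
      rw [Finset.card_filter, Nat.cast_sum]
      exact Finset.sum_congr rfl fun k _ => by simp [Set.indicator_apply]
    refine hcount.trans_le (Nat.cast_le.2 ?_)
    exact Finset.card_le_card_of_injOn Subtype.val
      (fun k hk => by simpa [commonNeighbors, S] using hk) Subtype.val_injective.injOn
  have hsub : {w | ((commonNeighbors (fun i j => t i j w) i j).card : ℝ) ≤ (n - 1) * p ^ 2 / 2} ⊆
      {w | ∑ k, (S k).indicator (fun _ => (1 : ℝ)) w ≤ (n - 1) * p ^ 2 / 2} :=
    fun w hw => (hle w).trans hw
  exact (measureReal_mono hsub).trans htail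

lemma measureReal_residual_large_le (hM : IsModel P F β T p t a) (hF : ∀ x, F x = 1 - F (-x))
    (hF0 : ∀ x, 0 ≤ F x) (hT : 1 ≤ T) (hn : 2 ≤ n) :
    P.real {w | ∃ i, 2 * T * √(n * Real.log n) ≤
      |residual F (fun i j => t i j w) (fun i j => a i j w) β i|} ≤ 4 / n := by
  have hn2 : (2 : ℝ) ≤ n := by exact_mod_cast hn
  have hlog : 0 ≤ Real.log n := Real.log_nonneg (by linarith)
  have hT0 : (0 : ℝ) < T := by exact_mod_cast hT
  have htail : ∀ i, P.real {w | 2 * T * √(n * Real.log n) ≤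
      |residual F (fun i j => t i j w) (fun i j => a i j w) β i|} ≤ 2 / (n : ℝ) ^ 2 := fun i => by
    refine (hM.measureReal_le_abs_residual_le hF hF0 i (by positivity)).trans_eq ?_
    have hexponent : -(2 * T * √(n * Real.log n)) ^ 2 / (2 * (n * (T : ℝ) ^ 2)) =
        -Real.log ((n : ℝ) ^ 2) := by
      rw [mul_pow, Real.sq_sqrt (by positivity), Real.log_pow]
      push_cast
      field_simp
    rw [hexponent, Real.exp_neg, Real.exp_log (by positivity), div_eq_mul_inv]
  rw [Set.ofPred_exists]
  calc _ ≤ ∑ i : Fin (n + 1), 2 / (n : ℝ) ^ 2 :=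
        (measureReal_iUnion_fintype_le _).trans (Finset.sum_le_sum fun i _ => htail i)
    _ = (n + 1) * (2 / (n : ℝ) ^ 2) := by simp
    _ ≤ (2 * n) * (2 / (n : ℝ) ^ 2) := by gcongr; linarith
    _ = 4 / n := by field_simp; norm_num

lemma measureReal_card_commonNeighbors_small_le (hM : IsModel P F β T p t a) (hT : 1 ≤ T)
    (hp0 : 0 < p) (hp1 : p ≤ 1) (hn : 2 ≤ n) (hlog : Real.log n ≤ n * p ^ 4 / 16) :
    P.real {w | ∃ x : {x : Fin (n + 1) × Fin (n + 1) // x.1 ≠ x.2},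
      ((commonNeighbors (fun i j => t i j w) x.1.1 x.1.2).card : ℝ) ≤ n * p ^ 2 / 4} ≤ 4 / n := by
  have hn2 : (2 : ℝ) ≤ n := by exact_mod_cast hn
  have htail : ∀ x : {x : Fin (n + 1) × Fin (n + 1) // x.1 ≠ x.2}, P.real {w |
      ((commonNeighbors (fun i j => t i j w) x.1.1 x.1.2).card : ℝ) ≤ n * p ^ 2 / 4}
        ≤ 1 / (n : ℝ) ^ 3 := fun x => by
    have hthreshold : n * p ^ 2 / 4 ≤ (n - 1) * p ^ 2 / 2 := by nlinarith [sq_nonneg p]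
    have hexponent : Real.log ((n : ℝ) ^ 3) ≤ (n - 1) * p ^ 4 / 2 := by
      rw [Real.log_pow]
      push_cast
      nlinarith [pow_pos hp0 4]
    calc _ ≤ Real.exp (-((n - 1) * p ^ 4 / 2)) := (measureReal_mono fun w hw =>
          le_trans hw hthreshold).trans (hM.measureReal_card_commonNeighbors_le_le hT hp0 hp1 x.2)
      _ ≤ Real.exp (-Real.log ((n : ℝ) ^ 3)) := Real.exp_le_exp.2 (neg_le_neg hexponent)
      _ = 1 / (n : ℝ) ^ 3 := by rw [Real.exp_neg, Real.exp_log (by positivity), one_div]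
  have hcard : (Fintype.card {x : Fin (n + 1) × Fin (n + 1) // x.1 ≠ x.2} : ℝ)
      ≤ (n + 1) * (n + 1) := by
    exact_mod_cast (Fintype.card_subtype_le _).trans_eq (by simp)
  rw [Set.ofPred_exists]
  calc _ ≤ ∑ _x : {x : Fin (n + 1) × Fin (n + 1) // x.1 ≠ x.2}, 1 / (n : ℝ) ^ 3 :=
        (measureReal_iUnion_fintype_le _).trans (Finset.sum_le_sum fun x _ => htail x)
    _ = Fintype.card {x : Fin (n + 1) × Fin (n + 1) // x.1 ≠ x.2} * (1 / (n : ℝ) ^ 3) := by simp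
    _ ≤ (2 * n) * (2 * n) * (1 / (n : ℝ) ^ 3) := by
        gcongr
        nlinarith
    _ = 4 / n := by field_simp; norm_num

lemma measureReal_not_isRegular_le (hM : IsModel P F β T p t a) (hF : ∀ x, F x = 1 - F (-x))
    (hF0 : ∀ x, 0 ≤ F x) (hT : 1 ≤ T) (hp0 : 0 < p) (hp1 : p ≤ 1) (hn : 2 ≤ n)
    (hlog : Real.log n ≤ n * p ^ 4 / 16) :
    P.real {w | ¬ IsRegular F (fun i j => t i j w) (fun i j => a i j w) β
      (2 * T * √(n * Real.log n)) (n * p ^ 2 / 4)} ≤ 8 / n := by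
  have hsum := add_le_add (hM.measureReal_residual_large_le hF hF0 hT hn)
    (hM.measureReal_card_commonNeighbors_small_le hT hp0 hp1 hn hlog)
  refine (measureReal_mono fun w hw => ?_).trans
    ((measureReal_union_le _ _).trans (hsum.trans_eq (by ring)))
  by_contra hnot
  simp only [Set.mem_union, Set.mem_ofPred_eq, not_or, not_exists, not_le, Subtype.forall,
    Prod.forall] at hnot
  exact hw ⟨fun i => (hnot.1 i).le, fun i k hik => (hnot.2 i k hik).le⟩

end IsModel

end Model

section FiniteSample

variable {n : ℕ} {F : ℝ → ℝ} {β : Fin (n + 1) → ℝ} {ε c p : ℝ} {T : ℕ}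

/-- The event that moment estimators exist and all of them are within `R` of `β`. -/
def EstimatesWithin (F : ℝ → ℝ) (t a : Fin (n + 1) → Fin (n + 1) → ℕ) (β : Fin (n + 1) → ℝ)
    (R : ℝ) : Prop :=
  (∃ b, IsMomentEstimator F t a b) ∧ ∀ b, IsMomentEstimator F t a b → ‖b - β‖ ≤ R

/-- The rate of the deviation bound for a growth constant `c` and comparison probability `p`. It is
`rate` without the factor `(b1 / b0) ^ 2`. -/
noncomputable def sharpRate (c p : ℝ) (n : ℕ) : ℝ :=
  √(Real.log n / n) / (c * p ^ 2)

lemma sharpRate_nonneg (hc : 0 ≤ c) (p : ℝ) (n : ℕ) : 0 ≤ sharpRate c p n :=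
  div_nonneg (Real.sqrt_nonneg _) (mul_nonneg hc (sq_nonneg p))

lemma natCast_mul_sqrt_log_div (n : ℕ) : n * √(Real.log n / n) = √(n * Real.log n) := by
  rw [← Real.sqrt_sq (Nat.cast_nonneg (α := ℝ) n), ← Real.sqrt_mul (sq_nonneg _),
    Real.sqrt_sq (Nat.cast_nonneg n), sq, mul_assoc]
  rcases n.eq_zero_or_pos with rfl | hn
  · simp only [Nat.cast_zero, zero_mul]
  · rw [mul_div_cancel₀ _ (Nat.cast_pos.2 hn).ne']

lemma IsRegular.estimatesWithin {t a : Fin (n + 1) → Fin (n + 1) → ℕ} (hn : 1 ≤ n)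
    (h : IsTally t a) (hF : ∀ x, F x = 1 - F (-x)) (hFc : Continuous F) (hβ : β 0 = 0)
    (hc : 0 < c) (hp : 0 < p) (hg : GrowsAt F β ε c) (hε : 16 * T * sharpRate c p n < ε)
    (hreg : IsRegular F t a β (2 * T * √(n * Real.log n)) (n * p ^ 2 / 4)) :
    EstimatesWithin F t a β (16 * T * sharpRate c p n) := by
  have hn0 : (0 : ℝ) < n := Nat.cast_pos.2 hn
  have hR : 0 ≤ 16 * T * sharpRate c p n :=
    mul_nonneg (by positivity) (sharpRate_nonneg hc.le p n)
  have hN : 0 < n * p ^ 2 / 4 := by positivity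
  have hHN : 2 * (2 * T * √(n * Real.log n)) =
      c * (16 * T * sharpRate c p n) * (n * p ^ 2 / 4) := by
    rw [← natCast_mul_sqrt_log_div, sharpRate]
    field_simp
    ring
  refine ⟨h.exists_isMomentEstimator hF hFc hc.le (hR.trans_lt hε) hg hreg ?_,
    fun b hb => hb.norm_sub_le h hF hβ hc hR hε hg hreg hN hHN.le⟩
  rw [hHN]
  exact mul_lt_mul_of_pos_right (mul_lt_mul_of_pos_left hε hc) hN

lemma IsModel.measureReal_not_estimatesWithin_le {Ω : Type*} [MeasurableSpace Ω] {P : Measure Ω}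
    [IsProbabilityMeasure P] {t a : Fin (n + 1) → Fin (n + 1) → Ω → ℕ}
    (hM : IsModel P F β T p t a) (hF : ∀ x, F x = 1 - F (-x)) (hF0 : ∀ x, 0 ≤ F x)
    (hFc : Continuous F) (hβ : β 0 = 0) (hT : 1 ≤ T) (hp0 : 0 < p) (hp1 : p ≤ 1) (hc : 0 < c)
    (hg : GrowsAt F β ε c) (hε : 16 * T * sharpRate c p n < ε) (hn : 2 ≤ n)
    (hlog : Real.log n ≤ n * p ^ 4 / 16) :
    P.real {w | ¬ EstimatesWithin F (fun i j => t i j w) (fun i j => a i j w) β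
      (16 * T * sharpRate c p n)} ≤ 8 / n :=
  (measureReal_mono (Set.ofPred_subset_ofPred.2 fun w => mt fun hreg => hreg.estimatesWithin
    (one_le_two.trans hn) (hM.isTally w) hF hFc hβ hc hp0 hg hε)).trans
    (hM.measureReal_not_isRegular_le hF hF0 hT hp0 hp1 hn hlog)

end FiniteSample

section Neighborhood

lemma card_mul_le_of_monotone {ι : Type*} {F : ℝ → ℝ} (hmono : Monotone F) (hF0 : ∀ x, 0 ≤ F x)
    {f : ι → ℝ} {c δ : ℝ} (hsep : ∀ i j, i ≠ j → δ ≤ |f i - f j|)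
    (hgrow : ∀ i, F (f i) + c ≤ F (f i + δ)) (s : Finset ι) :
    ∀ z, (∀ i ∈ s, f i + δ ≤ z) → s.card * c ≤ F z := by
  classical
  induction s using Finset.induction_on_max_value f with
  | empty => exact fun z _ => by simpa only [Finset.card_empty, Nat.cast_zero, zero_mul] using hF0 z
  | insert i s his hmax ih =>
    intro z hz
    have hbelow : s.card * c ≤ F (f i) := ih (f i) fun j hj => by
      have hgap := hsep i j (fun h => his (h ▸ hj))
      rw [abs_of_nonneg (sub_nonneg.2 (hmax j hj))] at hgap
      linarith
    rw [Finset.card_insert_of_notMem his, Nat.cast_succ, add_one_mul]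
    linarith [hgrow i, hmono (hz i (Finset.mem_insert_self i s))]

variable {F : ℝ → ℝ} {ε c : ℝ}

lemma growsAt_of_le_deriv {ι : Type*} {β : ι → ℝ} (hmono : Monotone F) (hd : Differentiable ℝ F)
    (hε : 0 ≤ ε) (hc : ∀ i j, i ≠ j → ∀ x, |x - (β i - β j)| ≤ ε → c ≤ deriv F x) :
    GrowsAt F β ε c := by
  intro i j hij u hu
  have hmin : 0 ≤ min u ε := le_min hu hε
  have hslope := (convex_Icc (β i - β j) (β i - β j + ε)).mul_sub_le_image_sub_of_le_deriv
    hd.continuous.continuousOn hd.differentiableOn (C := c) (fun x hx => by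
      rw [interior_Icc] at hx
      exact hc i j hij x (abs_le.2 ⟨by linarith [hx.1], by linarith [hx.2]⟩))
    (β i - β j) ⟨le_rfl, by linarith⟩ (β i - β j + min u ε)
    ⟨by linarith, by linarith [min_le_right u ε]⟩ (by linarith)
  rw [add_sub_cancel_left] at hslope
  linarith [hmono (show β i - β j + min u ε ≤ β i - β j + u by linarith [min_le_left u ε])]

lemma GrowsAt.mul_le_one {ι : Type*} [Nontrivial ι] {β : ι → ℝ} (hg : GrowsAt F β ε c)
    (hF0 : ∀ x, 0 ≤ F x) (hF1 : ∀ x, F x ≤ 1) (hε : 0 ≤ ε) : c * ε ≤ 1 := by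
  obtain ⟨i, j, hij⟩ := exists_pair_ne ι
  have hgrow := hg i j hij ε hε
  rw [min_self] at hgrow
  linarith [hF0 (β i - β j), hF1 (β i - β j + ε)]

lemma GrowsAt.exists_close {n : ℕ} {β : Fin (n + 1) → ℝ} (hg : GrowsAt F β ε c)
    (hmono : Monotone F) (hF0 : ∀ x, 0 ≤ F x) (hF1 : ∀ x, F x ≤ 1) (hε : 0 ≤ ε)
    (hn : 2 < n * (c * ε)) : ∃ i j, i ≠ j ∧ |β i - β j| ≤ ε / 2 := by
  by_contra! hfar
  have hgrow : ∀ i : Fin n, F (β i.succ - β 0) + c * (ε / 2) ≤ F (β i.succ - β 0 + ε / 2) :=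
    fun i => by
      have hi := hg i.succ 0 i.succ_ne_zero (ε / 2) (by linarith)
      rw [min_eq_left (by linarith)] at hi
      linarith
  obtain ⟨z, hz⟩ := (Set.finite_range fun i : Fin n => β i.succ - β 0 + ε / 2).bddAbove
  have hcard := card_mul_le_of_monotone hmono hF0 (f := fun i : Fin n => β i.succ - β 0)
    (fun i j hij => by
      rw [sub_sub_sub_cancel_right]
      exact (hfar _ _ ((Fin.succ_injective n).ne hij)).le) hgrow Finset.univ z
    fun i _ => hz ⟨i, rfl⟩
  rw [Finset.card_univ, Fintype.card_fin] at hcard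
  linarith [hF1 z]

lemma exists_deriv_deriv_ne_zero (hF0 : ∀ x, 0 ≤ F x) (hF1 : ∀ x, F x ≤ 1)
    (hd : Differentiable ℝ F) (hd' : Differentiable ℝ (deriv F)) {x : ℝ} (hx : deriv F x ≠ 0) :
    ∃ y, deriv (deriv F) y ≠ 0 := by
  by_contra! hzero
  have haffine := is_const_of_deriv_eq_zero (f := fun y => F y - deriv F x * y) (by fun_prop)
    (fun y => by
      rw [deriv_fun_sub (hd y) (by fun_prop), deriv_const_mul_field, deriv_id'', mul_one,
        is_const_of_deriv_eq_zero hd' hzero y x, sub_self]) (2 / deriv F x) 0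
  simp only [mul_div_cancel₀ _ hx, mul_zero, sub_zero] at haffine
  linarith [hF0 0, hF1 (2 / deriv F x)]

end Neighborhood

section Asymptotics

lemma IsBigOp.mono {Ω : ℕ → Type*} [∀ n, MeasurableSpace (Ω n)] {P : ∀ n, Measure (Ω n)}
    [∀ n, IsFiniteMeasure (P n)] {X : ∀ n, Ω n → ℝ} {r s : ℕ → ℝ} (h : IsBigOp P X r)
    (hrs : r ≤ᶠ[atTop] s) : IsBigOp P X s := by
  intro δ hδ
  obtain ⟨M, hM, hbound⟩ := h δ hδ
  refine ⟨M, hM, ?_⟩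
  filter_upwards [hbound, hrs] with n hn hle
  exact (measureReal_mono (Set.ofPred_subset_ofPred.2 fun w hw =>
    (mul_le_mul_of_nonneg_left hle hM.le).trans_lt hw)).trans hn

lemma IsBigOp.isLittleOpOne {Ω : ℕ → Type*} [∀ n, MeasurableSpace (Ω n)] {P : ∀ n, Measure (Ω n)}
    [∀ n, IsFiniteMeasure (P n)] {X : ∀ n, Ω n → ℝ} {r : ℕ → ℝ} (h : IsBigOp P X r)
    (hr : Tendsto r atTop (𝓝 0)) : IsLittleOpOne P X := by
  intro η hη
  refine tendsto_order.2 ⟨fun x hx => Eventually.of_forall fun n => hx.trans_le measureReal_nonneg,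
    fun δ hδ => ?_⟩
  obtain ⟨M, -, hbound⟩ := h (δ / 2) (half_pos hδ)
  have hMr : ∀ᶠ n in atTop, M * r n ≤ η :=
    (hr.const_mul M).eventually_le_const (by rwa [mul_zero])
  filter_upwards [hbound, hMr] with n hn hle
  exact ((measureReal_mono (Set.ofPred_subset_ofPred.2 fun w hw => hle.trans_lt hw)).trans
    hn).trans_lt (half_lt_self hδ)

variable {F : ℝ → ℝ} {βs : ∀ n : ℕ, Fin (n + 1) → ℝ} {ε b0 b1 b2 p : ℕ → ℝ}

lemma eventually_log_le (hF0 : ∀ x, 0 ≤ F x) (hF1 : ∀ x, F x ≤ 1) (hp : ∀ n, 0 < p n)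
    (hε0 : ∀ n, 0 < ε n) (hb0 : ∀ n, 0 < b0 n) (hg : ∀ n, GrowsAt F (βs n) (ε n) (b0 n))
    (hε : (fun n => sharpRate (b0 n) (p n) n) =o[atTop] ε) :
    ∀ᶠ n : ℕ in atTop, Real.log n ≤ n * p n ^ 4 / 16 := by
  filter_upwards [hε.bound (show (0 : ℝ) < 1 / 4 by norm_num), eventually_ge_atTop 1] with n hr hn
  have hbp : 0 < b0 n * p n ^ 2 := mul_pos (hb0 n) (pow_pos (hp n) 2)
  have : Nontrivial (Fin (n + 1)) := Fin.nontrivial_iff_two_le.2 (by omega)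
  rw [Real.norm_of_nonneg (sharpRate_nonneg (hb0 n).le _ _), Real.norm_of_nonneg (hε0 n).le,
    sharpRate, div_le_iff₀ hbp] at hr
  have hsqrt : √(Real.log n / n) ≤ p n ^ 2 / 4 := by
    nlinarith [(hg n).mul_le_one hF0 hF1 (hε0 n).le, sq_nonneg (p n)]
  rw [Real.sqrt_le_left (by positivity), div_le_iff₀ (Nat.cast_pos.2 hn)] at hsqrt
  linarith

lemma eventually_exists_close (hmono : Monotone F) (hF0 : ∀ x, 0 ≤ F x) (hF1 : ∀ x, F x ≤ 1)
    (hp : ∀ n, 0 < p n ∧ p n ≤ 1) (hε0 : ∀ n, 0 < ε n) (hb0 : ∀ n, 0 < b0 n)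
    (hg : ∀ n, GrowsAt F (βs n) (ε n) (b0 n))
    (hε : (fun n => sharpRate (b0 n) (p n) n) =o[atTop] ε) :
    ∀ᶠ n in atTop, ∃ i j, i ≠ j ∧ |βs n i - βs n j| ≤ ε n / 2 := by
  have hlim : Tendsto (fun n : ℕ => √(n * Real.log n)) atTop atTop :=
    Real.tendsto_sqrt_atTop.comp (tendsto_natCast_atTop_atTop.atTop_mul_atTop₀
      (Real.tendsto_log_atTop.comp tendsto_natCast_atTop_atTop))
  filter_upwards [hlim.eventually_gt_atTop 2, hε.bound one_pos] with n h2 hr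
  have hbp : 0 < b0 n * p n ^ 2 := mul_pos (hb0 n) (pow_pos (hp n).1 2)
  rw [Real.norm_of_nonneg (sharpRate_nonneg (hb0 n).le _ _), Real.norm_of_nonneg (hε0 n).le,
    one_mul, sharpRate, div_le_iff₀ hbp] at hr
  refine (hg n).exists_close hmono hF0 hF1 (hε0 n).le (h2.trans_le ?_)
  rw [← natCast_mul_sqrt_log_div]
  refine mul_le_mul_of_nonneg_left (hr.trans ?_) (Nat.cast_nonneg n)
  rw [mul_comm]
  exact mul_le_mul_of_nonneg_right
    (mul_le_of_le_one_right (hb0 n).le (pow_le_one₀ (hp n).1.le (hp n).2)) (hε0 n).le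

lemma sharpRate_le_of_growth {c d p δ x : ℝ} {n : ℕ} (hn : 2 ≤ n) (hc : 0 < c) (hp : 0 < p)
    (hδ : 0 ≤ δ) (hx : 0 < x) (hxd : x ≤ d)
    (hgrowth : d / (c ^ 2 * p ^ 4) ≤ x * δ ^ 2 * (n / Real.log n)) :
    sharpRate c p n ≤ δ := by
  have hn1 : (1 : ℝ) < n := by exact_mod_cast hn
  have hlog : 0 < Real.log n := Real.log_pos hn1
  have hq : 0 < Real.log n / n := div_pos hlog (by linarith)
  refine le_of_sq_le_sq ?_ hδ
  refine le_of_mul_le_mul_left ?_ hx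
  calc x * sharpRate c p n ^ 2 = x / (c ^ 2 * p ^ 4) * (Real.log n / n) := by
        rw [sharpRate, div_pow, Real.sq_sqrt hq.le]
        ring
    _ ≤ d / (c ^ 2 * p ^ 4) * (Real.log n / n) := by gcongr
    _ ≤ x * δ ^ 2 * (n / Real.log n) * (Real.log n / n) := by gcongr
    _ = x * δ ^ 2 := by field_simp

/-- A point where `F''` does not vanish enters a large neighbourhood of any close pair of merits, so
that `b2` is bounded below there and the growth condition controls the rate. -/
lemma tendsto_sharpRate (hmono : Monotone F) (hF0 : ∀ x, 0 ≤ F x) (hF1 : ∀ x, F x ≤ 1)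
    (hp : ∀ n, 0 < p n ∧ p n ≤ 1) (hε0 : ∀ n, 0 < ε n) (hb0 : ∀ n, 0 < b0 n)
    (hg : ∀ n, GrowsAt F (βs n) (ε n) (b0 n))
    (hsecond : ∀ n i j, i ≠ j → ∀ x, |x - (βs n i - βs n j)| ≤ ε n → |deriv (deriv F) x| ≤ b2 n)
    {x : ℝ} (hx : deriv (deriv F) x ≠ 0)
    (hε : (fun n => sharpRate (b0 n) (p n) n) =o[atTop] ε)
    (hgrowth : (fun n => b2 n / (b0 n ^ 2 * p n ^ 4)) =o[atTop]
      (fun n : ℕ => (n : ℝ) / Real.log n)) :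
    Tendsto (fun n => sharpRate (b0 n) (p n) n) atTop (𝓝 0) := by
  have hx0 : 0 < |deriv (deriv F) x| := abs_pos.2 hx
  refine tendsto_order.2 ⟨fun y hy => Eventually.of_forall fun n =>
    hy.trans_le (sharpRate_nonneg (hb0 n).le _ _), fun δ hδ => ?_⟩
  suffices h : ∀ᶠ n in atTop, sharpRate (b0 n) (p n) n ≤ δ / 2 from
    h.mono fun n hn => hn.trans_lt (half_lt_self hδ)
  filter_upwards [eventually_exists_close hmono hF0 hF1 hp hε0 hb0 hg hε,
    hε.bound (show 0 < δ / 2 / (2 * |x| + 1) by positivity),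
    hgrowth.bound (show 0 < |deriv (deriv F) x| * (δ / 2) ^ 2 by positivity),
    eventually_ge_atTop 2] with n ⟨i, j, hij, hclose⟩ hr hb2 hn
  rw [Real.norm_of_nonneg (sharpRate_nonneg (hb0 n).le _ _), Real.norm_of_nonneg (hε0 n).le] at hr
  rcases le_or_gt (ε n) (2 * |x| + 1) with hsmall | hlarge
  · refine hr.trans ?_
    rw [div_mul_eq_mul_div, div_le_iff₀ (by positivity)]
    exact mul_le_mul_of_nonneg_left hsmall (by positivity)
  · refine sharpRate_le_of_growth hn (hb0 n) (hp n).1 (half_pos hδ).le hx0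
      (hsecond n i j hij x ((abs_sub _ _).trans (by linarith))) ((le_abs_self _).trans ?_)
    rwa [← Real.norm_eq_abs, ← Real.norm_of_nonneg
      (div_nonneg (Nat.cast_nonneg n) (Real.log_natCast_nonneg n))]

section Consistency

variable {T : ℕ} {Ω : ℕ → Type*} [∀ n, MeasurableSpace (Ω n)] {P : ∀ n, Measure (Ω n)}
  [∀ n, IsProbabilityMeasure (P n)] {t a : ∀ n : ℕ, Fin (n + 1) → Fin (n + 1) → Ω n → ℕ}

lemma tendsto_measureReal_not_estimatesWithin (hF : ∀ x, F x = 1 - F (-x))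
    (hF0 : ∀ x, 0 ≤ F x) (hF1 : ∀ x, F x ≤ 1) (hFc : Continuous F) (hT : 1 ≤ T)
    (hp : ∀ n, 0 < p n ∧ p n ≤ 1) (hβs : ∀ n, βs n 0 = 0)
    (hM : ∀ n, IsModel (P n) F (βs n) T (p n) (t n) (a n)) (hε0 : ∀ n, 0 < ε n)
    (hb0 : ∀ n, 0 < b0 n) (hg : ∀ n, GrowsAt F (βs n) (ε n) (b0 n))
    (hε : (fun n => sharpRate (b0 n) (p n) n) =o[atTop] ε) :
    Tendsto (fun n => (P n).real {w | ¬ EstimatesWithin F (fun i j => t n i j w)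
      (fun i j => a n i j w) (βs n) (16 * T * sharpRate (b0 n) (p n) n)}) atTop (𝓝 0) := by
  have hT0 : (0 : ℝ) < T := Nat.cast_pos.2 hT
  refine squeeze_zero' (Eventually.of_forall fun n => measureReal_nonneg) ?_
    (tendsto_const_div_atTop_nhds_zero_nat 8)
  filter_upwards [eventually_log_le hF0 hF1 (fun n => (hp n).1) hε0 hb0 hg hε,
    hε.bound (show 0 < 1 / (32 * (T : ℝ)) by positivity), eventually_ge_atTop 2] with n hlog hr hn
  rw [Real.norm_of_nonneg (sharpRate_nonneg (hb0 n).le _ _), Real.norm_of_nonneg (hε0 n).le,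
    div_mul_eq_mul_div, one_mul, le_div_iff₀ (by positivity)] at hr
  exact (hM n).measureReal_not_estimatesWithin_le hF hF0 hFc (hβs n) hT (hp n).1 (hp n).2 (hb0 n)
    (hg n) (by linarith [hε0 n]) hn hlog

variable {R : ℕ → ℝ}

lemma tendsto_measureReal_exists_isMomentEstimator
    (h : Tendsto (fun n => (P n).real {w | ¬ EstimatesWithin F (fun i j => t n i j w)
      (fun i j => a n i j w) (βs n) (R n)}) atTop (𝓝 0)) :
    Tendsto (fun n => (P n).real {w | ∃ b : Fin (n + 1) → ℝ, IsMomentEstimator F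
      (fun i j => t n i j w) (fun i j => a n i j w) b}) atTop (𝓝 1) := by
  refine tendsto_of_tendsto_of_tendsto_of_le_of_le (by simpa only [sub_zero] using h.const_sub 1)
    tendsto_const_nhds (fun n => ?_) fun n => measureReal_le_one
  rw [sub_le_iff_le_add]
  rw [← probReal_univ (μ := P n)]
  refine (measureReal_mono fun w _ => ?_).trans (measureReal_union_le _ _)
  by_cases hw : EstimatesWithin F (fun i j => t n i j w) (fun i j => a n i j w) (βs n) (R n)
  exacts [Or.inl hw.1, Or.inr hw]

lemma isBigOp_norm_sub {C : ℝ} {r : ℕ → ℝ} (hC : 0 < C)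
    (h : Tendsto (fun n => (P n).real {w | ¬ EstimatesWithin F (fun i j => t n i j w)
      (fun i j => a n i j w) (βs n) (C * r n)}) atTop (𝓝 0))
    {βhat : ∀ n : ℕ, Ω n → Fin (n + 1) → ℝ}
    (hβhat : ∀ n w, (∃ b : Fin (n + 1) → ℝ, IsMomentEstimator F
        (fun i j => t n i j w) (fun i j => a n i j w) b) →
      IsMomentEstimator F (fun i j => t n i j w) (fun i j => a n i j w) (βhat n w)) :
    IsBigOp P (fun n w => ‖βhat n w - βs n‖) r := by
  refine fun δ hδ => ⟨C, hC, (h.eventually_le_const hδ).mono fun n hn => ?_⟩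
  refine (measureReal_mono (Set.ofPred_subset_ofPred.2 fun w hw hwithin => ?_)).trans hn
  rw [abs_norm] at hw
  exact hw.not_ge (hwithin.2 _ (hβhat n w hwithin.1))

end Consistency

end Asymptotics

section DerivBounds

variable {n : ℕ} {F : ℝ → ℝ} {β : Fin (n + 1) → ℝ} {ε b0 b1 b2 : ℝ}

lemma exists_perturbation (hβ : β 0 = 0) {i j : Fin (n + 1)} (hij : i ≠ j) {x : ℝ}
    (hx : |x - (β i - β j)| ≤ ε) :
    ∃ b : Fin (n + 1) → ℝ, b 0 = 0 ∧ (∀ k, |b k - β k| ≤ ε) ∧ b i - b j = x := by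
  have hupdate : ∀ l y, |y - β l| ≤ ε → ∀ k, |Function.update β l y k - β k| ≤ ε := by
    intro l y hy k
    by_cases hk : k = l
    · rwa [hk, Function.update_self]
    · rw [Function.update_of_ne hk, sub_self, abs_zero]
      exact (abs_nonneg _).trans hy
  by_cases hi : i = 0
  · have hj : 0 ≠ j := hi ▸ hij
    refine ⟨Function.update β j (β i - x), by rw [Function.update_of_ne hj, hβ],
      hupdate _ _ ?_, by rw [Function.update_self, Function.update_of_ne hij, sub_sub_cancel]⟩
    rwa [sub_right_comm, abs_sub_comm]
  · refine ⟨Function.update β i (β j + x), by rw [Function.update_of_ne (Ne.symm hi), hβ],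
      hupdate _ _ ?_,
      by rw [Function.update_self, Function.update_of_ne hij.symm, add_sub_cancel_left]⟩
    rwa [show β j + x - β i = x - (β i - β j) by ring]

namespace DerivBounds

lemma le_deriv (hB : DerivBounds F β ε b0 b1 b2) (hmono : Monotone F) (hβ : β 0 = 0)
    (i j : Fin (n + 1)) (hij : i ≠ j) (x : ℝ) (hx : |x - (β i - β j)| ≤ ε) : b0 ≤ deriv F x := by
  obtain ⟨b, hb0, hb, rfl⟩ := exists_perturbation hβ hij hx
  exact (hB.first b hb0 hb i j hij).1.trans_eq (abs_of_nonneg hmono.deriv_nonneg)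

lemma abs_deriv_deriv_le (hB : DerivBounds F β ε b0 b1 b2) (hβ : β 0 = 0)
    (i j : Fin (n + 1)) (hij : i ≠ j) (x : ℝ) (hx : |x - (β i - β j)| ≤ ε) :
    |deriv (deriv F) x| ≤ b2 := by
  obtain ⟨b, hb0, hb, rfl⟩ := exists_perturbation hβ hij hx
  exact hB.second b hb0 hb i j hij

lemma lower_le_upper (hB : DerivBounds F β ε b0 b1 b2) (hβ : β 0 = 0) (hε : 0 ≤ ε)
    (hn : 1 ≤ n) : b0 ≤ b1 := by
  have hfirst := hB.first β hβ (fun i => by rwa [sub_self, abs_zero]) 0 (Fin.last n)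
    (Fin.ne_of_lt (Fin.lt_def.2 hn))
  exact hfirst.1.trans hfirst.2

end DerivBounds

lemma sharpRate_le_rate {b0 b1 p : ℕ → ℝ} {n : ℕ} (hb0 : 0 < b0 n) (hb : b0 n ≤ b1 n)
    (hp : 0 < p n) : sharpRate (b0 n) (p n) n ≤ rate b0 b1 p n := by
  rw [show rate b0 b1 p n = (b1 n / b0 n) ^ 2 * sharpRate (b0 n) (p n) n by
    rw [rate, sharpRate]; field_simp]
  exact le_mul_of_one_le_left (sharpRate_nonneg hb0.le _ _) (one_le_pow₀ ((one_le_div hb0).2 hb))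

lemma isBigO_sharpRate_rate {b0 b1 p : ℕ → ℝ} (hb0 : ∀ n, 0 < b0 n)
    (hb : ∀ᶠ n in atTop, b0 n ≤ b1 n) (hp : ∀ n, 0 < p n) :
    (fun n => sharpRate (b0 n) (p n) n) =O[atTop] rate b0 b1 p := by
  refine IsBigO.of_bound' (hb.mono fun n hn => ?_)
  rw [Real.norm_of_nonneg (sharpRate_nonneg (hb0 n).le _ _)]
  exact (sharpRate_le_rate (hb0 n) hn (hp n)).trans (Real.le_norm_self _)

lemma isLittleO_div_log {b0 b1 b2 p : ℕ → ℝ} (hb0 : ∀ n, 0 < b0 n)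
    (hb : ∀ᶠ n in atTop, b0 n ≤ b1 n)
    (hgrowth : (fun n => b1 n ^ 4 * b2 n / (b0 n ^ 6 * p n ^ 4)) =o[atTop]
      (fun n : ℕ => √((n : ℝ) / Real.log n))) :
    (fun n => b2 n / (b0 n ^ 2 * p n ^ 4)) =o[atTop] (fun n : ℕ => (n : ℝ) / Real.log n) := by
  refine (IsBigO.of_bound' ?_).trans_isLittleO (hgrowth.trans_isBigO (IsBigO.of_bound' ?_))
  · filter_upwards [hb] with n hn
    have hone : 1 ≤ (b1 n / b0 n) ^ 4 := one_le_pow₀ ((one_le_div (hb0 n)).2 hn)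
    rw [show b1 n ^ 4 * b2 n / (b0 n ^ 6 * p n ^ 4) =
      (b1 n / b0 n) ^ 4 * (b2 n / (b0 n ^ 2 * p n ^ 4)) by have := hb0 n; field_simp, norm_mul]
    exact le_mul_of_one_le_left (norm_nonneg _) (hone.trans (Real.le_norm_self _))
  · filter_upwards [eventually_ge_atTop 2] with n hn
    have hn1 : (1 : ℝ) < n := by exact_mod_cast hn
    have hone : 1 ≤ n / Real.log n := by
      rw [one_le_div (Real.log_pos hn1)]
      exact Real.log_le_self (by linarith)
    rw [Real.norm_of_nonneg (Real.sqrt_nonneg _), Real.norm_of_nonneg (by linarith),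
      Real.sqrt_le_left (by linarith)]
    exact le_self_pow₀ hone two_ne_zero

end DerivBounds

end PairedComparison

open PairedComparison in
theorem mainTheorem1_general {F : ℝ → ℝ} (hmono : Monotone F) (hF0 : ∀ x, 0 ≤ F x)
    (hF : ∀ x, F x = 1 - F (-x)) (hd : Differentiable ℝ F) (hd' : Differentiable ℝ (deriv F))
    {T : ℕ} (hT : 1 ≤ T) {p : ℕ → ℝ} (hp : ∀ n, 0 < p n ∧ p n ≤ 1)
    {βs : ∀ n : ℕ, Fin (n + 1) → ℝ} (hβs : ∀ n, βs n 0 = 0)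
    {Ω : ℕ → Type*} [∀ n, MeasurableSpace (Ω n)]
    {P : ∀ n, Measure (Ω n)} [∀ n, IsProbabilityMeasure (P n)]
    {t a : ∀ n : ℕ, Fin (n + 1) → Fin (n + 1) → Ω n → ℕ}
    (hM : ∀ n, IsModel (P n) F (βs n) T (p n) (t n) (a n))
    {ε b0 b2 : ℕ → ℝ} (hε0 : ∀ n, 0 < ε n) (hb0 : ∀ n, 0 < b0 n)
    (hfirst : ∀ n i j, i ≠ j → ∀ x, |x - (βs n i - βs n j)| ≤ ε n → b0 n ≤ deriv F x)
    (hsecond : ∀ n i j, i ≠ j → ∀ x, |x - (βs n i - βs n j)| ≤ ε n → |deriv (deriv F) x| ≤ b2 n)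
    (hε : (fun n => sharpRate (b0 n) (p n) n) =o[atTop] ε)
    (hgrowth : (fun n => b2 n / (b0 n ^ 2 * p n ^ 4)) =o[atTop]
      (fun n : ℕ => (n : ℝ) / Real.log n)) :
    Tendsto (fun n => (P n).real {w | ∃ b : Fin (n + 1) → ℝ,
      IsMomentEstimator F (fun i j => t n i j w) (fun i j => a n i j w) b}) atTop (𝓝 1) ∧
    ∀ βhat : ∀ n : ℕ, Ω n → Fin (n + 1) → ℝ,
      (∀ n w, (∃ b : Fin (n + 1) → ℝ,
          IsMomentEstimator F (fun i j => t n i j w) (fun i j => a n i j w) b) →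
        IsMomentEstimator F (fun i j => t n i j w) (fun i j => a n i j w) (βhat n w)) →
      IsBigOp P (fun n w => ‖βhat n w - βs n‖) (fun n => sharpRate (b0 n) (p n) n) ∧
      IsLittleOpOne P (fun n w => ‖βhat n w - βs n‖) := by
  have hF1 : ∀ x, F x ≤ 1 := fun x => by linarith [hF x, hF0 (-x)]
  have hT0 : (0 : ℝ) < T := Nat.cast_pos.2 hT
  have hg : ∀ n, GrowsAt F (βs n) (ε n) (b0 n) := fun n =>
    growsAt_of_le_deriv hmono hd (hε0 n).le (hfirst n)
  have hwithin := tendsto_measureReal_not_estimatesWithin hF hF0 hF1 hd.continuous hT hp hβs hM hε0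
    hb0 hg hε
  have hderiv : deriv F (βs 1 0 - βs 1 1) ≠ 0 := ((hb0 1).trans_le
    (hfirst 1 0 1 zero_ne_one _ (by rw [sub_self, abs_zero]; exact (hε0 1).le))).ne'
  obtain ⟨x, hx⟩ := exists_deriv_deriv_ne_zero hF0 hF1 hd hd' hderiv
  have hrate := tendsto_sharpRate hmono hF0 hF1 hp hε0 hb0 hg hsecond hx hε hgrowth
  refine ⟨tendsto_measureReal_exists_isMomentEstimator hwithin, fun βhat hβhat => ?_⟩
  have hbig := isBigOp_norm_sub (mul_pos (by norm_num) hT0) hwithin hβhat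
  exact ⟨hbig, hbig.isLittleOpOne hrate⟩

theorem mainTheorem1
    -- the known symmetric, three times differentiable distribution function `F = cdf ν`
    (ν : Measure ℝ) [IsProbabilityMeasure ν]
    (hsymm : ∀ x, cdf ν x = 1 - cdf ν (-x))
    (hd1 : Differentiable ℝ (cdf ν)) (hd2 : Differentiable ℝ (deriv (cdf ν)))
    (hd3 : Differentiable ℝ (deriv (deriv (cdf ν))))
    -- the design and the true merits
    (T : ℕ) (hT : 1 ≤ T)
    (p : ℕ → ℝ) (hp : ∀ n, 0 < p n ∧ p n ≤ 1)
    (βs : ∀ n : ℕ, Fin (n + 1) → ℝ) (hβs : ∀ n, βs n 0 = 0)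
    -- the data
    {Ω : ℕ → Type*} [∀ n, MeasurableSpace (Ω n)]
    (P : ∀ n, Measure (Ω n)) [∀ n, IsProbabilityMeasure (P n)]
    (t a : ∀ n : ℕ, Fin (n + 1) → Fin (n + 1) → Ω n → ℕ)
    (hmodel : ∀ n, PairedComparison.IsModel (P n) (cdf ν) (βs n) T (p n) (t n) (a n))
    -- the bounds on the derivatives near the true merits
    (ε b0 b1 b2 : ℕ → ℝ)
    (hpos : ∀ n, 0 < ε n ∧ 0 < b0 n ∧ 0 < b1 n ∧ 0 < b2 n)
    (hbounds : ∀ n, PairedComparison.DerivBounds (cdf ν) (βs n) (ε n) (b0 n) (b1 n) (b2 n))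
    -- the neighbourhood is large compared with the rate
    (hε : PairedComparison.rate b0 b1 p =o[atTop] ε)
    -- the growth condition
    (hgrowth : (fun n => b1 n ^ 4 * b2 n / (b0 n ^ 6 * p n ^ 4)) =o[atTop]
      (fun n : ℕ => √((n : ℝ) / Real.log n))) :
    Tendsto (fun n => (P n).real {w | ∃ b : Fin (n + 1) → ℝ,
      PairedComparison.IsMomentEstimator (cdf ν)
        (fun i j => t n i j w) (fun i j => a n i j w) b}) atTop (𝓝 1) ∧
    ∀ βhat : ∀ n : ℕ, Ω n → Fin (n + 1) → ℝ,
      (∀ n w, (∃ b : Fin (n + 1) → ℝ, PairedComparison.IsMomentEstimator (cdf ν)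
          (fun i j => t n i j w) (fun i j => a n i j w) b) →
        PairedComparison.IsMomentEstimator (cdf ν)
          (fun i j => t n i j w) (fun i j => a n i j w) (βhat n w)) →
      PairedComparison.IsBigOp P (fun n w => ‖βhat n w - βs n‖)
        (PairedComparison.rate b0 b1 p) ∧
      PairedComparison.IsLittleOpOne P (fun n w => ‖βhat n w - βs n‖) := by
  have hle : ∀ᶠ n in atTop, b0 n ≤ b1 n := (eventually_ge_atTop 1).mono fun n =>
    (hbounds n).lower_le_upper (hβs n) (hpos n).1.le
  have hO := PairedComparison.isBigO_sharpRate_rate (fun n => (hpos n).2.1) hle fun n => (hp n).1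
  obtain ⟨hexists, hconsistent⟩ := mainTheorem1_general (monotone_cdf ν) (cdf_nonneg ν) hsymm hd1
    hd2 hT hp hβs hmodel (fun n => (hpos n).1) (fun n => (hpos n).2.1)
    (fun n => (hbounds n).le_deriv (monotone_cdf ν) (hβs n))
    (fun n => (hbounds n).abs_deriv_deriv_le (hβs n)) (hO.trans_isLittleO hε)
    (PairedComparison.isLittleO_div_log (fun n => (hpos n).2.1) hle hgrowth)
  exact ⟨hexists, fun βhat hβhat => ⟨(hconsistent βhat hβhat).1.mono (hle.mono fun n hn =>
    PairedComparison.sharpRate_le_rate (hpos n).2.1 hn (hp n).1),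
    (hconsistent βhat hβhat).2⟩⟩
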